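/- Let $T=\{z\in\mathbb C:|z|=1\}$, and let $n\ge 0$ be an integer. For $\mathbf z=(z_1,\dots,z_n)\in T^n$ (repetitions allowed) and $z\in T$ put $$G_{\mathbf z}(z)=\sum_{j=1}^n\frac1{|z-z_j|^2}\in[0,\infty],$$ where a term with $z=z_j$ equals $\infty$, and $M(\mathbf z)=\min_{z\in T}G_{\mathbf z}(z)$. Call $\mathbf z$ locally extremal if it has a neighbourhood $U$ in $T^n$ (product topology) such that $M(\mathbf z')\le M(\mathbf z)$ for all $\mathbf z'\in U$. (1) For all $z_1,\dots,z_n\in T$ there is $z\in T$, different from every $z_j$, such that $$\sum_{j=1}^n\frac1{|z-z_j|^2}\le\frac{n^2}4 .$$ (2) (Equivalent real form: the strong polarization conjecture in dimension $2$.) For all unit vectors $u_1,\dots,u_n\in\mathbb R^2$ there is a unit vector $v\in\mathbb R^2$ with $\langle u_i,v\rangle\ne0$ for every $i$ and $$\sum_{i=1}^n\frac1{\langle u_i,v\rangle^2}\le n^2 .$$ (3) If $\mathbf z\in T^n$ is locally extremal, then $M(\mathbf z)=n^2/4$, and this value is attained: $G_{\mathbf z}(w)=n^2/4$ for some $w\in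 T$. -/

import Mathlib

open scoped ENNReal

noncomputable section

/-- The function `G_𝐳(w) = ∑ⱼ 1 / |w - zⱼ|²` on the unit circle, with values in `[0, ∞]`:
it has the value `∞` at the poles `w = zⱼ`. -/
def circleSum {n : ℕ} (z : Fin n → Circle) (w : Circle) : ℝ≥0∞ :=
  ∑ j, 1 / ENNReal.ofReal (‖(w : ℂ) - (z j : ℂ)‖ ^ 2)

/-- `M(𝐳)`, the minimum over the unit circle of `G_𝐳`. -/
def circleMin {n : ℕ} (z : Fin n → Circle) : ℝ≥0∞ :=
  ⨅ w : Circle, circleSum z w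

/-- A configuration `𝐳 ∈ Tⁿ` is locally extremal if `M(𝐳') ≤ M(𝐳)` for all `𝐳'` in some
neighbourhood of `𝐳` in the product topology of `Tⁿ`. -/
def LocallyExtremal {n : ℕ} (z : Fin n → Circle) : Prop :=
  ∃ U ∈ nhds z, ∀ z' ∈ U, circleMin z' ≤ circleMin z

end

/-! On the circle `-z ζ / (z - ζ)²` equals `1 / |z - ζ|²`. Hence, for `P = ∏ (X - z_j)` and `θ = X
d/dX`, the sum `G` is the restriction of `θ² log P = (P θ²P - (θP)²) / P²`.

At a locally extremal configuration the points are distinct: splitting a coincident pair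
symmetrically raises `G` near every minimizer, by convexity of the kernel. No direction of motion
raises `G` to first order at all minimizers, so Gordan's alternative gives weights on the minimizers
for which each `z_j` is a critical point of the weighted kernel sum with poles at the weighted
minimizers. Since the kernel slope decreases strictly between poles, such a sum has no more critical
points than poles (`card_zeros_le_card_poles`). Used in both directions, this gives exactly `n`
minimizers, interlacing with the `z_j`.

Let `R` be the monic polynomial with the minimizers as roots. Double zeros and degrees force `P θ²P
- (θP)² - M P² = -M R²` (`eulerHess_sub_eq`). Thus `(θP)² = M R²` at the roots of `P`; interlacing
makes the sign of the square root constant (`prod_sin_mul_prod_sin_pos`), so `θP = ρ R + (n - ρ) P`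
with `ρ² = M`. Eliminating `R` and reading off the constant coefficient yields `(n - ρ)² = ρ²`, so
`M = n² / 4` (`const_eq_of_eulerHess_eq`).

A global maximizer of `M` exists by compactness and is locally extremal, which gives the bound for
all configurations; doubling angles gives the real form. -/

/-! ### Counting separated finite sets. -/

/-- If any two points of `A` are separated by a point of `B`, then `#A ≤ #B + 1`. -/
lemma card_le_card_add_one_of_separated {A B : Finset ℝ}
    (h : ∀ a ∈ A, ∀ a' ∈ A, a < a' → ∃ b ∈ B, a < b ∧ b < a') : A.card ≤ B.card + 1 := by
  classical
  rw [← Finset.card_range (B.card + 1)]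
  have hlt : ∀ a ∈ A, ∀ a' ∈ A, a < a' →
      (B.filter (· < a)).card < (B.filter (· < a')).card := by
    intro a ha a' ha' haa
    obtain ⟨b, hb, h1, h2⟩ := h a ha a' ha' haa
    apply Finset.card_lt_card
    rw [Finset.ssubset_iff_of_subset]
    · exact ⟨b, by simp [hb, h2], by simp [h1.le]⟩
    · intro c hc
      simp only [Finset.mem_filter] at hc ⊢
      exact ⟨hc.1, hc.2.trans haa⟩
  refine Finset.card_le_card_of_injOn (fun a => (B.filter (· < a)).card) ?_ ?_
  · intro a _
    simp only [Finset.coe_range, Set.mem_Iio]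
    exact Nat.lt_succ_of_le (Finset.card_filter_le _ _)
  · intro a ha a' ha' haa
    rcases lt_trichotomy a a' with h1 | h1 | h1
    · exact absurd haa (hlt a ha a' ha' h1).ne
    · exact h1
    · exact absurd haa (hlt a' ha' a ha h1).ne'

/-- If the points of `A` are cyclically separated by the points of `B`, then `#A ≤ #B`. -/
lemma card_le_card_of_cyclically_separated {A B : Finset ℝ}
    (h : ∀ a ∈ A, ∀ a' ∈ A, a < a' → ∃ b ∈ B, a < b ∧ b < a')
    (h' : ∀ a ∈ A, ∀ a' ∈ A, a ≤ a' → ∃ b ∈ B, b < a ∨ a' < b) : A.card ≤ B.card := by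
  classical
  rcases A.eq_empty_or_nonempty with rfl | hA
  · simp
  -- A point of `B` outside `[min A, max A]` separates no pair of `A`, so it can be erased; this
  -- saves the `+ 1` of the linear count.
  obtain ⟨b, hb, hb'⟩ := h' _ (A.min'_mem hA) _ (A.max'_mem hA) (A.min'_le_max' hA)
  rw [← Finset.card_erase_add_one hb]
  apply card_le_card_add_one_of_separated
  intro a ha a' ha' haa
  obtain ⟨c, hc, h1, h2⟩ := h a ha a' ha' haa
  refine ⟨c, Finset.mem_erase.2 ⟨?_, hc⟩, h1, h2⟩
  rintro rfl
  have := A.min'_le a ha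
  have := A.le_max' a' ha'
  rcases hb' with h3 | h3 <;> linarith

/-! ### The kernel slope and its monotonicity. -/

/-- Up to the factor `-1/2`, the derivative of `u ↦ 1 / (2 - 2 cos u)`. -/
noncomputable def kernelSlope (u : ℝ) : ℝ := Real.sin u / (1 - Real.cos u) ^ 2

lemma kernelSlope_neg (u : ℝ) : kernelSlope (-u) = -kernelSlope u := by
  simp [kernelSlope, neg_div]

lemma kernelSlope_add_two_pi (u : ℝ) : kernelSlope (u + 2 * Real.pi) = kernelSlope u := by
  simp [kernelSlope]

lemma one_sub_cos_eq (u : ℝ) : 1 - Real.cos u = 2 * Real.sin (u / 2) ^ 2 := by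
  have := Real.cos_sq' (u / 2)
  have h2 := Real.cos_two_mul (u / 2)
  rw [mul_div_cancel₀ u two_ne_zero] at h2
  linarith

lemma kernelSlope_eq {u : ℝ} (hu : Real.sin (u / 2) ≠ 0) :
    kernelSlope u = (Real.cos (u / 2) / Real.sin (u / 2) +
      (Real.cos (u / 2) / Real.sin (u / 2)) ^ 3) / 2 := by
  have h1 : Real.sin u = 2 * Real.sin (u / 2) * Real.cos (u / 2) := by
    rw [← Real.sin_two_mul, mul_div_cancel₀ u two_ne_zero]
  have h2 := Real.sin_sq_add_cos_sq (u / 2)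
  rw [kernelSlope, one_sub_cos_eq, h1]
  field_simp
  linear_combination (-Real.cos (u / 2)) * h2

/-- The slope is `(cot + cot³) / 2` at the half angle. As `y - x < 2π`, the sign hypothesis says
that no pole, i.e. no multiple of `2π`, lies in `[x, y]`, and there `cot` of the half angle
decreases. -/
lemma kernelSlope_lt {x y : ℝ} (hxy : x < y) (hyx : y < x + 2 * Real.pi)
    (h : 0 < Real.sin (x / 2) * Real.sin (y / 2)) : kernelSlope y < kernelSlope x := by
  have hx : Real.sin (x / 2) ≠ 0 := left_ne_zero_of_mul h.ne'
  have hy : Real.sin (y / 2) ≠ 0 := right_ne_zero_of_mul h.ne'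
  rw [kernelSlope_eq hx, kernelSlope_eq hy]
  have hd : 0 < Real.sin (y / 2 - x / 2) :=
    Real.sin_pos_of_pos_of_lt_pi (by linarith) (by linarith)
  have hc : Real.cos (y / 2) / Real.sin (y / 2) < Real.cos (x / 2) / Real.sin (x / 2) := by
    rw [← sub_pos]
    have : Real.cos (x / 2) / Real.sin (x / 2) - Real.cos (y / 2) / Real.sin (y / 2) =
        Real.sin (y / 2 - x / 2) / (Real.sin (x / 2) * Real.sin (y / 2)) := by
      rw [Real.sin_sub]; field_simp
    rw [this]; positivity
  have h3 := (Odd.strictMono_pow (R := ℝ) (n := 3) (by decide)) hc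
  simp only at h3
  linarith

lemma sum_kernelSlope_lt {P : Finset ℝ} (hP : P.Nonempty) {c : ℝ → ℝ} (hc : ∀ p ∈ P, 0 < c p)
    {x y : ℝ} (hxy : x < y) (hyx : y < x + 2 * Real.pi)
    (h : ∀ p ∈ P, 0 < Real.sin ((x - p) / 2) * Real.sin ((y - p) / 2)) :
    ∑ p ∈ P, c p * kernelSlope (y - p) < ∑ p ∈ P, c p * kernelSlope (x - p) := by
  refine Finset.sum_lt_sum_of_nonempty hP fun p hp => ?_
  exact mul_lt_mul_of_pos_left
    (kernelSlope_lt (by linarith) (by linarith) (h p hp)) (hc p hp)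

lemma sin_half_mul_pos {x y p : ℝ} (hx : x ∈ Set.Ioc (-Real.pi) Real.pi)
    (hy : y ∈ Set.Ioc (-Real.pi) Real.pi) (hp : p ∈ Set.Ioc (-Real.pi) Real.pi)
    (h : (p < x ∧ p < y) ∨ (x < p ∧ y < p)) :
    0 < Real.sin ((x - p) / 2) * Real.sin ((y - p) / 2) := by
  obtain ⟨_, _⟩ := hx
  obtain ⟨_, _⟩ := hy
  obtain ⟨_, _⟩ := hp
  rcases h with ⟨h1, h2⟩ | ⟨h1, h2⟩
  · exact mul_pos (Real.sin_pos_of_pos_of_lt_pi (by linarith) (by linarith))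
      (Real.sin_pos_of_pos_of_lt_pi (by linarith) (by linarith))
  · exact mul_pos_of_neg_of_neg (Real.sin_neg_of_neg_of_neg_pi_lt (by linarith) (by linarith))
      (Real.sin_neg_of_neg_of_neg_pi_lt (by linarith) (by linarith))

lemma sin_half_mul_neg {x y p : ℝ} (hx : x ∈ Set.Ioc (-Real.pi) Real.pi)
    (hy : y ∈ Set.Ioc (-Real.pi) Real.pi) (h1 : x < p) (h2 : p < y) :
    Real.sin ((x - p) / 2) * Real.sin ((y - p) / 2) < 0 := by
  obtain ⟨_, _⟩ := hx
  obtain ⟨_, _⟩ := hy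
  exact mul_neg_of_neg_of_pos (Real.sin_neg_of_neg_of_neg_pi_lt (by linarith) (by linarith))
    (Real.sin_pos_of_pos_of_lt_pi (by linarith) (by linarith))

/-! ### Critical points are cyclically separated by poles. -/

section Separation

variable {P Z : Finset ℝ} (hP : P.Nonempty) {c : ℝ → ℝ} (hc : ∀ p ∈ P, 0 < c p)
  (hPI : ∀ p ∈ P, p ∈ Set.Ioc (-Real.pi) Real.pi) (hZI : ∀ z ∈ Z, z ∈ Set.Ioc (-Real.pi) Real.pi)
  (hPZ : ∀ p ∈ P, p ∉ Z) (hZ : ∀ z ∈ Z, ∑ p ∈ P, c p * kernelSlope (z - p) = 0)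

include hP hc hPI hZI hPZ hZ

/-- Between two zeros of the derivative of a positive combination of kernels there is a pole. -/
lemma exists_pole_between {x y : ℝ} (hx : x ∈ Z) (hy : y ∈ Z) (hxy : x < y) :
    ∃ p ∈ P, x < p ∧ p < y := by
  by_contra! hcon
  have h := sum_kernelSlope_lt hP hc hxy
    (by have := (hZI x hx).1; have := (hZI y hy).2; linarith) (fun p hp => ?_)
  · rw [hZ x hx, hZ y hy] at h
    exact lt_irrefl _ h
  · refine sin_half_mul_pos (hZI x hx) (hZI y hy) (hPI p hp) ?_
    have hpx : p ≠ x := fun h => hPZ p hp (h ▸ hx)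
    have hpy : p ≠ y := fun h => hPZ p hp (h ▸ hy)
    rcases lt_or_gt_of_ne hpx with h1 | h1
    · exact Or.inl ⟨h1, h1.trans hxy⟩
    · exact Or.inr ⟨h1, lt_of_le_of_ne (hcon p hp h1) hpy.symm⟩

/-- Monotonicity on the complementary arc, from `y` to `x + 2π`, which returns to the zero `x` by
periodicity. If `x = y`, any pole will do. -/
lemma exists_pole_outside {x y : ℝ} (hx : x ∈ Z) (hy : y ∈ Z) (hxy : x ≤ y) :
    ∃ p ∈ P, p < x ∨ y < p := by
  rcases hxy.eq_or_lt with rfl | hxy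
  · obtain ⟨p, hp⟩ := hP
    exact ⟨p, hp, lt_or_gt_of_ne fun h => hPZ p hp (h ▸ hx)⟩
  by_contra! hcon
  have hx1 := hZI x hx
  have hy1 := hZI y hy
  have h := sum_kernelSlope_lt hP hc (x := y) (y := x + 2 * Real.pi)
    (by linarith [hx1.1, hy1.2]) (by linarith) (fun p hp => ?_)
  · have e : ∀ p, x + 2 * Real.pi - p = x - p + 2 * Real.pi := fun p => by ring
    simp only [e, kernelSlope_add_two_pi] at h
    rw [hZ x hx, hZ y hy] at h
    exact lt_irrefl _ h
  · have hpx : p ≠ x := fun h => hPZ p hp (h ▸ hx)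
    have hpy : p ≠ y := fun h => hPZ p hp (h ▸ hy)
    have h1 := lt_of_le_of_ne (hcon p hp).1 hpx.symm
    have h2 := lt_of_le_of_ne (hcon p hp).2 hpy
    obtain ⟨_, _⟩ := hPI p hp
    exact mul_pos (Real.sin_pos_of_pos_of_lt_pi (by linarith) (by linarith [hx1.1, hy1.2]))
      (Real.sin_pos_of_pos_of_lt_pi (by linarith [hx1.1]) (by linarith))

/-- The derivative of a positive combination of kernels has at most as many zeros as poles. -/
lemma card_zeros_le_card_poles : Z.card ≤ P.card :=
  card_le_card_of_cyclically_separated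
    (fun _ ha _ ha' h => exists_pole_between hP hc hPI hZI hPZ hZ ha ha' h)
    (fun _ ha _ ha' h => exists_pole_outside hP hc hPI hZI hPZ hZ ha ha' h)

end Separation

/-! ### Signs of sine products for interlacing sets. -/

lemma neg_one_pow_mul_prod_pos {ι : Type*} (s : Finset ι) (p : ι → Prop) [DecidablePred p]
    {f : ι → ℝ} (h1 : ∀ i ∈ s, p i → f i < 0) (h2 : ∀ i ∈ s, ¬ p i → 0 < f i) :
    0 < (-1 : ℝ) ^ (s.filter p).card * ∏ i ∈ s, f i := by
  have : (-1 : ℝ) ^ (s.filter p).card = ∏ i ∈ s, if p i then (-1 : ℝ) else 1 := by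
    simp [Finset.prod_ite]
  rw [this, ← Finset.prod_mul_distrib]
  refine Finset.prod_pos fun i hi => ?_
  split_ifs with h
  · linarith [h1 i hi h]
  · linarith [h2 i hi h]

/-- For interlacing sets `T`, `S` of angles, the products
`∏_{t ≠ a} sin ((a - t) / 2) * ∏ₛ sin ((a - s) / 2)` have the same sign for all `a ∈ T`. -/
lemma prod_sin_mul_prod_sin_pos {T S : Finset ℝ}
    (hTI : ∀ p ∈ T, p ∈ Set.Ioc (-Real.pi) Real.pi) (hSI : ∀ p ∈ S, p ∈ Set.Ioc (-Real.pi) Real.pi)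
    (hTS : ∀ p ∈ T, p ∉ S)
    (h1 : ∀ a ∈ T, ∀ a' ∈ T, a < a' → ∃ b ∈ S, a < b ∧ b < a')
    (h2 : ∀ a ∈ S, ∀ a' ∈ S, a < a' → ∃ b ∈ T, a < b ∧ b < a')
    {a b : ℝ} (ha : a ∈ T) (hb : b ∈ T) (hab : a < b) :
    0 < ((∏ t ∈ T.erase a, Real.sin ((a - t) / 2)) * ∏ s ∈ S, Real.sin ((a - s) / 2)) *
      ((∏ t ∈ T.erase b, Real.sin ((b - t) / 2)) * ∏ s ∈ S, Real.sin ((b - s) / 2)) := by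
  classical
  set T' := (T.erase a).erase b with hT'
  set k := (S.filter fun s => a < s ∧ s < b).card with hk
  set l := (T'.filter fun s => a < s ∧ s < b).card with hl
  -- By interlacing, the open interval `(a, b)` contains one more point of `S` than of `T`.
  have hkl : k = l + 1 := by
    apply le_antisymm
    · apply card_le_card_add_one_of_separated
      intro x hx y hy hxy
      simp only [Finset.mem_filter] at hx hy
      obtain ⟨c, hc, hc1, hc2⟩ := h2 x hx.1 y hy.1 hxy
      refine ⟨c, ?_, hc1, hc2⟩
      have e1 : a < c := hx.2.1.trans hc1
      have e2 : c < b := hc2.trans hy.2.2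
      simp [hT', hc, e1, e2, e1.ne', e2.ne]
    · have h3 : (insert a (insert b (T'.filter fun s => a < s ∧ s < b))).card ≤ k + 1 := by
        apply card_le_card_add_one_of_separated
        intro x hx y hy hxy
        have key : ∀ z ∈ insert a (insert b (T'.filter fun s => a < s ∧ s < b)),
            z ∈ T ∧ a ≤ z ∧ z ≤ b := by
          intro z hz
          simp only [Finset.mem_insert, Finset.mem_filter, hT', Finset.mem_erase] at hz
          rcases hz with rfl | rfl | hz
          · exact ⟨ha, le_rfl, hab.le⟩
          · exact ⟨hb, hab.le, le_rfl⟩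
          · exact ⟨hz.1.2.2, hz.2.1.le, hz.2.2.le⟩
        obtain ⟨hx1, hx2, hx3⟩ := key x hx
        obtain ⟨hy1, hy2, hy3⟩ := key y hy
        obtain ⟨c, hc, hc1, hc2⟩ := h1 x hx1 y hy1 hxy
        refine ⟨c, ?_, hc1, hc2⟩
        simp only [Finset.mem_filter]
        exact ⟨hc, hx2.trans_lt hc1, hc2.trans_le hy3⟩
      rw [Finset.card_insert_of_notMem (by simp [hT', hab.ne]),
        Finset.card_insert_of_notMem (by simp [hT'])] at h3
      omega
  -- The paired factors at `a` and `b` have opposite signs exactly for points strictly between them.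
  -- The resulting sign `(-1)^(k + l) = -1` is cancelled by the pair `sin ((a - b) / 2)`, `sin ((b -
  -- a) / 2)`.
  have hsign : ∀ U : Finset ℝ, (∀ p ∈ U, p ∈ Set.Ioc (-Real.pi) Real.pi) → a ∉ U → b ∉ U →
      0 < (-1 : ℝ) ^ (U.filter fun s => a < s ∧ s < b).card *
        ∏ s ∈ U, (Real.sin ((a - s) / 2) * Real.sin ((b - s) / 2)) := by
    intro U hU haU hbU
    apply neg_one_pow_mul_prod_pos
    · intro s _ hs
      exact sin_half_mul_neg (hTI a ha) (hTI b hb) hs.1 hs.2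
    · intro s hs hn
      refine sin_half_mul_pos (hTI a ha) (hTI b hb) (hU s hs) ?_
      have hsa : s ≠ a := fun h => haU (h ▸ hs)
      have hsb : s ≠ b := fun h => hbU (h ▸ hs)
      rcases lt_or_gt_of_ne hsa with h | h
      · exact Or.inl ⟨h, h.trans hab⟩
      · exact Or.inr ⟨h, lt_of_le_of_ne (not_lt.1 fun h' => hn ⟨h, h'⟩) hsb.symm⟩
  have s1 := hsign S hSI (hTS a ha) (hTS b hb)
  have s2 := hsign T' (fun p hp => hTI p (Finset.mem_of_mem_erase (Finset.mem_of_mem_erase hp)))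
    (by simp [hT']) (by simp [hT'])
  rw [← hk, hkl] at s1
  rw [← hl] at s2
  have e1 : ∏ t ∈ T.erase a, Real.sin ((a - t) / 2) =
      Real.sin ((a - b) / 2) * ∏ t ∈ T', Real.sin ((a - t) / 2) :=
    (Finset.mul_prod_erase _ _ (Finset.mem_erase.2 ⟨hab.ne', hb⟩)).symm
  have e2 : ∏ t ∈ T.erase b, Real.sin ((b - t) / 2) =
      Real.sin ((b - a) / 2) * ∏ t ∈ T', Real.sin ((b - t) / 2) := by
    rw [hT', Finset.erase_right_comm]
    exact (Finset.mul_prod_erase _ _ (Finset.mem_erase.2 ⟨hab.ne, ha⟩)).symm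
  have e3 : Real.sin ((a - b) / 2) = - Real.sin ((b - a) / 2) := by
    rw [← Real.sin_neg]; ring_nf
  have e4 : 0 < Real.sin ((b - a) / 2) :=
    Real.sin_pos_of_pos_of_lt_pi (by linarith)
      (by linarith [(hTI a ha).1, (hTI b hb).2, Real.pi_pos])
  rw [Finset.prod_mul_distrib] at s1 s2
  rw [e1, e2, e3]
  have e5 : ((-1 : ℝ) ^ l) ^ 2 = 1 := by rw [← pow_mul, mul_comm, pow_mul]; simp
  have := mul_pos (mul_pos s1 s2) (pow_pos e4 2)
  calc _ < _ := this
    _ = _ := by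
      rw [pow_succ]
      linear_combination (-(∏ x ∈ S, Real.sin ((a - x) / 2)) * (∏ x ∈ S, Real.sin ((b - x) / 2)) *
        (∏ x ∈ T', Real.sin ((a - x) / 2)) * (∏ x ∈ T', Real.sin ((b - x) / 2)) *
        Real.sin ((b - a) / 2) ^ 2) * e5

/-! ### Polynomial identities for the Euler operator. -/

section EulerOperator

open Polynomial

/-- The Euler operator `X d/dX`. -/
noncomputable def eulerOp (p : ℂ[X]) : ℂ[X] := X * derivative p

/-- `p θ²p - (θp)²` for the Euler operator `θ`. -/
noncomputable def eulerHess (p : ℂ[X]) : ℂ[X] := p * eulerOp (eulerOp p) - eulerOp p ^ 2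

lemma coeff_eulerOp (p : ℂ[X]) (k : ℕ) : (eulerOp p).coeff k = k * p.coeff k := by
  cases k with
  | zero => simp [eulerOp]
  | succ k =>
    rw [eulerOp, coeff_X_mul, coeff_derivative]
    push_cast
    ring

lemma natDegree_eulerOp_le (p : ℂ[X]) : (eulerOp p).natDegree ≤ p.natDegree := by
  rw [natDegree_le_iff_coeff_eq_zero]
  intro k hk
  rw [coeff_eulerOp, coeff_eq_zero_of_natDegree_lt hk, mul_zero]

/-- This is additivity of `θ² log p = eulerHess p / p²`, with denominators cleared. -/
lemma eulerHess_mul (p q : ℂ[X]) :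
    eulerHess (p * q) = eulerHess p * q ^ 2 + p ^ 2 * eulerHess q := by
  simp only [eulerHess, eulerOp, derivative_mul, derivative_add, derivative_X]
  ring

lemma eulerHess_X_sub_C (a : ℂ) : eulerHess (X - C a) = - (C a * X) := by
  have h1 : eulerOp (X - C a) = X := by simp [eulerOp]
  have h2 : eulerOp (X : ℂ[X]) = X := by simp [eulerOp]
  rw [eulerHess, h1, h2]
  ring

lemma eval_eulerHess_prod {ι : Type*} (T : Finset ι) (f : ι → ℂ) (z : ℂ)
    (hz : ∀ t ∈ T, z - f t ≠ 0) :
    (eulerHess (∏ t ∈ T, (X - C (f t)))).eval z =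
      (∏ t ∈ T, (X - C (f t))).eval z ^ 2 * ∑ t ∈ T, -(z * f t) / (z - f t) ^ 2 := by
  classical
  induction T using Finset.induction_on with
  | empty => simp [eulerHess, eulerOp]
  | insert a s ha ih =>
    rw [Finset.prod_insert ha, eulerHess_mul, Finset.sum_insert ha, eulerHess_X_sub_C, eval_add,
      eval_mul, eval_mul, ih fun t ht => hz t (Finset.mem_insert_of_mem ht)]
    have h0 := hz a (Finset.mem_insert_self a s)
    simp only [eval_neg, eval_mul, eval_C, eval_X, eval_pow, eval_sub]
    field_simp

/-- Near `w` the polynomial is `(F - M) P²`, where `F` is the sum in `hM`; the sum in `hd` is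
`F'(w)`. So value and derivative both vanish at `w`. -/
lemma sq_dvd_of_critical {ι : Type*} (T : Finset ι) (f : ι → ℂ) (w M : ℂ)
    (hw : ∀ t ∈ T, w - f t ≠ 0) (hM : ∑ t ∈ T, -(w * f t) / (w - f t) ^ 2 = M)
    (hd : ∑ t ∈ T, f t * (w + f t) / (w - f t) ^ 3 = 0) :
    (X - C w) ^ 2 ∣ eulerHess (∏ t ∈ T, (X - C (f t))) - C M * (∏ t ∈ T, (X - C (f t))) ^ 2 := by
  set P := ∏ t ∈ T, (X - C (f t)) with hP
  set W := eulerHess P - C M * P ^ 2 with hW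
  rcases eq_or_ne W 0 with h0 | h0
  · rw [h0]; exact dvd_zero _
  rw [← le_rootMultiplicity_iff h0]
  have hev : ∀ z, (∀ t ∈ T, z - f t ≠ 0) →
      W.eval z = (∑ t ∈ T, -(z * f t) / (z - f t) ^ 2 - M) * P.eval z ^ 2 := by
    intro z hz
    rw [hW, eval_sub, hP, eval_eulerHess_prod T f z hz]
    simp only [eval_mul, eval_C, eval_pow]
    ring
  refine (one_lt_rootMultiplicity_iff_isRoot h0).2 ⟨?_, ?_⟩
  · rw [IsRoot.def, hev w hw, hM]; ring
  · have h1 : ∀ᶠ z in nhds w, ∀ t ∈ T, z - f t ≠ 0 := by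
      rw [Filter.eventually_all_finset]
      intro t ht
      exact ContinuousAt.eventually_ne (by fun_prop) (hw t ht)
    have h2 : HasDerivAt (fun z => ∑ t ∈ T, -(z * f t) / (z - f t) ^ 2 - M) 0 w := by
      rw [← hd]
      apply HasDerivAt.sub_const
      apply HasDerivAt.fun_sum
      intro t ht
      have h0 := hw t ht
      have h := ((hasDerivAt_id w).mul_const (f t)).neg.div
        (((hasDerivAt_id w).sub_const (f t)).pow 2) (pow_ne_zero 2 h0)
      refine h.congr_deriv ?_
      simp only [id, Pi.neg_apply, Pi.pow_apply]
      field_simp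
      push_cast
      ring
    have h3 := h2.mul ((P.hasDerivAt w).pow 2)
    have h4 : HasDerivAt (fun z => W.eval z) (W.derivative.eval w) w := W.hasDerivAt w
    have h5 := h4.unique (h3.congr_of_eventuallyEq (h1.mono fun z hz => by
      simpa using hev z hz))
    rw [IsRoot.def, h5, hM]
    simp

/-- A quadratic identity between monic polynomials of degree `n` determines the constant. -/
lemma const_eq_of_eulerHess_eq {n : ℕ} (hn : 0 < n) {P R : ℂ[X]} {M ρ : ℂ} (hP : P.Monic)
    (hP0 : P.coeff 0 ≠ 0)
    (hρ : ρ ^ 2 = M) (hW : eulerHess P - C M * P ^ 2 = - (C M * R ^ 2))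
    (hlin : eulerOp P = C ρ * R + C (n - ρ) * P) : M = n ^ 2 / 4 := by
  have h1 : P * (eulerOp (eulerOp P) - C (2 * (n - ρ)) * eulerOp P +
      C ((n - ρ) ^ 2 - M) * P) = 0 := by
    have h2 : C M = C ρ ^ 2 := by rw [← hρ, C_pow]
    have h3 : C ρ * R = eulerOp P - C (n - ρ) * P := by rw [hlin]; ring
    -- Since `M = ρ²`, the linear relation eliminates `R`, and every remaining term has a factor
    -- `P`.
    have h4 : C M * R ^ 2 = (eulerOp P - C (n - ρ) * P) ^ 2 := by rw [h2, ← h3]; ring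
    rw [h4, eulerHess] at hW
    rw [C_mul, C_sub (a := (n - ρ) ^ 2), C_pow, C_ofNat]
    linear_combination hW
  have h2 := (mul_eq_zero.1 h1).resolve_left hP.ne_zero
  have h3 := congrArg (fun p => p.coeff 0) h2
  simp only [coeff_add, coeff_sub, coeff_C_mul, coeff_eulerOp, coeff_zero] at h3
  -- `θ` kills constant coefficients, so only the last term survives.
  have h4 : (n - ρ) ^ 2 - M = 0 := by
    have : ((n - ρ) ^ 2 - M) * P.coeff 0 = 0 := by simpa using h3
    exact (mul_eq_zero.1 this).resolve_right hP0
  have h5 : (n : ℂ) * (n - 2 * ρ) = 0 := by linear_combination h4 - hρ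
  have h6 := (mul_eq_zero.1 h5).resolve_left (Nat.cast_ne_zero.2 hn.ne')
  rw [← hρ]
  linear_combination (-(n + 2 * ρ) / 4) * h6

/-- The difference of the two sides is divisible by `R²`, of degree `2n`. Its coefficient at `2n` is
`(n² - n²) - M + M = 0`, so it vanishes. -/
lemma eulerHess_sub_eq {T S : Finset ℝ} {f : ℝ → ℂ} (hTS : T.card = S.card)
    (hf : ∀ s ∈ S, ∀ t ∈ S, s ≠ t → f s ≠ f t) {M : ℂ}
    (hdvd : ∀ s ∈ S, (X - C (f s)) ^ 2 ∣
      eulerHess (∏ t ∈ T, (X - C (f t))) - C M * (∏ t ∈ T, (X - C (f t))) ^ 2) :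
    eulerHess (∏ t ∈ T, (X - C (f t))) - C M * (∏ t ∈ T, (X - C (f t))) ^ 2 =
      - (C M * (∏ s ∈ S, (X - C (f s))) ^ 2) := by
  set P := ∏ t ∈ T, (X - C (f t)) with hP
  set R := ∏ s ∈ S, (X - C (f s)) with hR
  have hPm : P.Monic := monic_prod_X_sub_C _ _
  have hRm : R.Monic := monic_prod_X_sub_C _ _
  have hPn : P.natDegree = T.card := natDegree_finsetProd_X_sub_C_eq_card _ _
  have hRn : R.natDegree = T.card := by
    rw [hTS]; exact natDegree_finsetProd_X_sub_C_eq_card _ _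
  set n := T.card
  have hRdvd : R ^ 2 ∣ eulerHess P - C M * P ^ 2 := by
    rw [hR, ← Finset.prod_pow]
    apply Finset.prod_dvd_of_coprime
    · intro s hs t ht hst
      exact ((isCoprime_X_sub_C_of_isUnit_sub
        (sub_ne_zero.2 (hf s hs t ht hst)).isUnit).pow)
    · exact hdvd
  have hPc : P.coeff n = 1 := hPn ▸ hPm.coeff_natDegree
  have hRc : R.coeff n = 1 := hRn ▸ hRm.coeff_natDegree
  have d1 : (eulerOp P).natDegree ≤ n := (natDegree_eulerOp_le P).trans hPn.le
  have d2 : (eulerOp (eulerOp P)).natDegree ≤ n := (natDegree_eulerOp_le _).trans d1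
  have key : ∀ p q : ℂ[X], p.natDegree ≤ n → q.natDegree ≤ n → ∀ k, n + n < k →
      (p * q).coeff k = 0 := fun p q hp hq k hk =>
    coeff_eq_zero_of_natDegree_lt
      ((natDegree_mul_le.trans (Nat.add_le_add hp hq)).trans_lt hk)
  rw [← sub_eq_zero, sub_neg_eq_add]
  apply eq_zero_of_dvd_of_degree_lt (p := R ^ 2)
  · exact dvd_add hRdvd (dvd_mul_left _ _)
  · rw [degree_eq_natDegree (hRm.pow 2).ne_zero, hRm.natDegree_pow, hRn,
      degree_lt_iff_coeff_zero]
    intro k hk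
    rw [eulerHess, sq, sq, sq, coeff_add, coeff_sub, coeff_sub, coeff_C_mul, coeff_C_mul]
    rcases hk.eq_or_lt with hk | hk
    · have : k = n + n := by omega
      subst this
      rw [coeff_mul_add_eq_of_natDegree_le hPn.le d2, coeff_mul_add_eq_of_natDegree_le d1 d1,
        coeff_mul_add_eq_of_natDegree_le hPn.le hPn.le, coeff_mul_add_eq_of_natDegree_le hRn.le hRn.le]
      simp only [coeff_eulerOp, hPc, hRc]
      ring
    · have hk' : n + n < k := by omega
      rw [key _ _ hPn.le d2 k hk', key _ _ d1 d1 k hk', key _ _ hPn.le hPn.le k hk',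
        key _ _ hRn.le hRn.le k hk']
      simp

/-- The sides agree at the `n` distinct roots of `P`; the factor `T.card - ρ` is chosen to match the
coefficients of degree `n` as well. -/
lemma eulerOp_eq_of_eval_eq {T S : Finset ℝ} {f : ℝ → ℂ} (hTS : T.card = S.card)
    (hf : ∀ s ∈ T, ∀ t ∈ T, s ≠ t → f s ≠ f t) {ρ : ℂ}
    (h : ∀ a ∈ T, (eulerOp (∏ t ∈ T, (X - C (f t)))).eval (f a) =
      ρ * (∏ s ∈ S, (X - C (f s))).eval (f a)) :
    eulerOp (∏ t ∈ T, (X - C (f t))) =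
      C ρ * (∏ s ∈ S, (X - C (f s))) + C (T.card - ρ) * ∏ t ∈ T, (X - C (f t)) := by
  set P := ∏ t ∈ T, (X - C (f t)) with hP
  set R := ∏ s ∈ S, (X - C (f s)) with hR
  have hPm : P.Monic := monic_prod_X_sub_C _ _
  have hRm : R.Monic := monic_prod_X_sub_C _ _
  have hPn : P.natDegree = T.card := natDegree_finsetProd_X_sub_C_eq_card _ _
  have hRn : R.natDegree = T.card := by
    rw [hTS]; exact natDegree_finsetProd_X_sub_C_eq_card _ _
  set n := T.card
  have hPc : P.coeff n = 1 := hPn ▸ hPm.coeff_natDegree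
  have hRc : R.coeff n = 1 := hRn ▸ hRm.coeff_natDegree
  rw [← sub_eq_zero]
  apply eq_zero_of_dvd_of_degree_lt (p := P)
  · rw [hP]
    apply Finset.prod_dvd_of_coprime
    · intro s hs t ht hst
      exact isCoprime_X_sub_C_of_isUnit_sub (sub_ne_zero.2 (hf s hs t ht hst)).isUnit
    · intro a ha
      rw [dvd_iff_isRoot, IsRoot.def, ← hP]
      have : P.eval (f a) = 0 := by
        rw [hP, eval_prod]; exact Finset.prod_eq_zero ha (by simp)
      simp [h a ha, this]
  · rw [degree_eq_natDegree hPm.ne_zero, hPn, degree_lt_iff_coeff_zero]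
    intro k hk
    rw [coeff_sub, coeff_add, coeff_C_mul, coeff_C_mul, coeff_eulerOp]
    rcases hk.eq_or_lt with hk | hk
    · rw [← hk, hPc, hRc]; ring
    · rw [coeff_eq_zero_of_natDegree_lt (hPn.trans_lt hk),
        coeff_eq_zero_of_natDegree_lt (hRn.trans_lt hk)]
      ring

lemma eval_eulerOp_prod {ι : Type*} [DecidableEq ι] {T : Finset ι} (f : ι → ℂ) {a : ι}
    (ha : a ∈ T) : (eulerOp (∏ t ∈ T, (X - C (f t)))).eval (f a) =
      f a * ∏ t ∈ T.erase a, (f a - f t) := by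
  rw [← Finset.mul_prod_erase T _ ha, eulerOp, derivative_mul]
  simp [eval_prod]

end EulerOperator

/-! ### From angles to polynomials, and the extremal value. -/

section Angles

open Complex

lemma exp_mul_I_sub (a b : ℝ) : exp (a * I) - exp (b * I) =
    2 * I * exp (a / 2 * I) * exp (b / 2 * I) * (Real.sin ((a - b) / 2) : ℝ) := by
  have h : ∀ x : ℝ, exp (x * I) = exp (x / 2 * I) ^ 2 := fun x => by
    rw [← Complex.exp_nat_mul]; congr 1; push_cast; ring
  have h1 : exp (-((a - b) / 2 * I)) = exp (b / 2 * I) / exp (a / 2 * I) := by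
    rw [← Complex.exp_sub]; congr 1; ring
  have h2 : exp ((a - b) / 2 * I) = exp (a / 2 * I) / exp (b / 2 * I) := by
    rw [← Complex.exp_sub]; congr 1; ring
  push_cast
  rw [Complex.sin, neg_mul, h1, h2, h, h]
  have := Complex.exp_ne_zero (a / 2 * I)
  have := Complex.exp_ne_zero (b / 2 * I)
  field_simp
  rw [I_sq]; ring

lemma exp_half_sq (a : ℝ) : exp (a / 2 * I) ^ 2 = exp (a * I) := by
  rw [← Complex.exp_nat_mul]; congr 1; push_cast; ring

lemma exp_mul_I_add (a b : ℝ) : exp (a * I) + exp (b * I) =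
    2 * exp (a / 2 * I) * exp (b / 2 * I) * (Real.cos ((a - b) / 2) : ℝ) := by
  have h1 : exp (-((a - b) / 2 * I)) = exp (b / 2 * I) / exp (a / 2 * I) := by
    rw [← Complex.exp_sub]; congr 1; ring
  have h2 : exp ((a - b) / 2 * I) = exp (a / 2 * I) / exp (b / 2 * I) := by
    rw [← Complex.exp_sub]; congr 1; ring
  push_cast
  rw [Complex.cos, neg_mul, h1, h2, ← exp_half_sq, ← exp_half_sq]
  have := Complex.exp_ne_zero (a / 2 * I)
  have := Complex.exp_ne_zero (b / 2 * I)
  field_simp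

lemma neg_mul_div_sub_sq {x t : ℝ} (h : Real.sin ((x - t) / 2) ≠ 0) :
    -(exp (x * I) * exp (t * I)) / (exp (x * I) - exp (t * I)) ^ 2 =
      ((1 / (2 - 2 * Real.cos (x - t)) : ℝ) : ℂ) := by
  have e : 2 - 2 * Real.cos (x - t) = 4 * Real.sin ((x - t) / 2) ^ 2 := by
    linarith [one_sub_cos_eq (x - t)]
  rw [exp_mul_I_sub, e, ← exp_half_sq x, ← exp_half_sq t]
  have h' : (Real.sin ((x - t) / 2) : ℂ) ≠ 0 := by exact_mod_cast h
  have := Complex.exp_ne_zero (x / 2 * I)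
  have := Complex.exp_ne_zero (t / 2 * I)
  have := I_ne_zero
  rw [Complex.ofReal_div, Complex.ofReal_mul, Complex.ofReal_pow]
  generalize (Real.sin ((x - t) / 2) : ℂ) = s at *
  field_simp
  rw [I_sq]; push_cast; ring

/-- The factor in front of the real slope does not depend on `t`, so the complex derivative vanishes
whenever the slopes sum to zero. -/
lemma mul_add_div_sub_cube {x t : ℝ} (h : Real.sin ((x - t) / 2) ≠ 0) :
    exp (t * I) * (exp (x * I) + exp (t * I)) / (exp (x * I) - exp (t * I)) ^ 3 =
      I / 2 / exp (x * I) * (kernelSlope (x - t) : ℝ) := by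
  have e : kernelSlope (x - t) = Real.cos ((x - t) / 2) / (2 * Real.sin ((x - t) / 2) ^ 3) := by
    have h1 : Real.sin (x - t) = 2 * Real.sin ((x - t) / 2) * Real.cos ((x - t) / 2) := by
      rw [← Real.sin_two_mul, mul_div_cancel₀ _ two_ne_zero]
    rw [kernelSlope, one_sub_cos_eq, h1]
    field_simp
  rw [exp_mul_I_sub, exp_mul_I_add, e, ← exp_half_sq x, ← exp_half_sq t]
  have h' : (Real.sin ((x - t) / 2) : ℂ) ≠ 0 := by exact_mod_cast h
  have := Complex.exp_ne_zero (x / 2 * I)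
  have := Complex.exp_ne_zero (t / 2 * I)
  have := I_ne_zero
  rw [Complex.ofReal_div, Complex.ofReal_mul, Complex.ofReal_pow]
  generalize (Real.sin ((x - t) / 2) : ℂ) = s at *
  generalize (Real.cos ((x - t) / 2) : ℂ) = c at *
  field_simp
  rw [show I ^ 4 = 1 from I_pow_four]; push_cast; ring

lemma sin_half_sub_ne_zero {a b : ℝ} (ha : a ∈ Set.Ioc (-Real.pi) Real.pi)
    (hb : b ∈ Set.Ioc (-Real.pi) Real.pi) (hab : a ≠ b) : Real.sin ((a - b) / 2) ≠ 0 := by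
  obtain ⟨_, _⟩ := ha
  obtain ⟨_, _⟩ := hb
  rcases lt_or_gt_of_ne hab with h | h
  · exact (Real.sin_neg_of_neg_of_neg_pi_lt (by linarith) (by linarith)).ne
  · exact (Real.sin_pos_of_pos_of_lt_pi (by linarith) (by linarith)).ne'

lemma exp_mul_I_sub_ne_zero {a b : ℝ} (h : Real.sin ((a - b) / 2) ≠ 0) :
    exp (a * I) - exp (b * I) ≠ 0 := by
  rw [exp_mul_I_sub]
  have h' : (Real.sin ((a - b) / 2) : ℂ) ≠ 0 := by exact_mod_cast h
  have := Complex.exp_ne_zero (a / 2 * I)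
  have := Complex.exp_ne_zero (b / 2 * I)
  have := I_ne_zero
  exact mul_ne_zero (by simp) h'

lemma prod_exp_sub (U : Finset ℝ) (a : ℝ) : ∏ s ∈ U, (exp (a * I) - exp (s * I)) =
    (2 * I) ^ U.card * exp (a / 2 * I) ^ U.card * (∏ s ∈ U, exp (s / 2 * I)) *
      ((∏ s ∈ U, Real.sin ((a - s) / 2) : ℝ) : ℂ) := by
  simp only [exp_mul_I_sub, Finset.prod_mul_distrib, Finset.prod_const, Complex.ofReal_prod]
  ring

/-- If the sum of kernels at the points of `T` has the same value `M` at `#T` critical points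
which interlace with `T`, then `M = (#T)² / 4`. -/
theorem value_eq_card_sq_div_four {T S : Finset ℝ} (hT : T.Nonempty) (hTS : T.card = S.card)
    (hTI : ∀ p ∈ T, p ∈ Set.Ioc (-Real.pi) Real.pi) (hSI : ∀ p ∈ S, p ∈ Set.Ioc (-Real.pi) Real.pi)
    (hdisj : ∀ p ∈ T, p ∉ S)
    (h1 : ∀ a ∈ T, ∀ a' ∈ T, a < a' → ∃ b ∈ S, a < b ∧ b < a')
    (h2 : ∀ a ∈ S, ∀ a' ∈ S, a < a' → ∃ b ∈ T, a < b ∧ b < a') {M : ℝ}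
    (hM : ∀ s ∈ S, ∑ t ∈ T, 1 / (2 - 2 * Real.cos (s - t)) = M)
    (hd : ∀ s ∈ S, ∑ t ∈ T, kernelSlope (s - t) = 0) : M = T.card ^ 2 / 4 := by
  classical
  set f : ℝ → ℂ := fun t => exp (t * I) with hf
  have hinj : ∀ a ∈ Set.Ioc (-Real.pi) Real.pi, ∀ b ∈ Set.Ioc (-Real.pi) Real.pi, a ≠ b →
      f a ≠ f b := fun a ha b hb hab =>
    sub_ne_zero.1 (exp_mul_I_sub_ne_zero (sin_half_sub_ne_zero ha hb hab))
  have hsin : ∀ s ∈ S, ∀ t ∈ T, Real.sin ((s - t) / 2) ≠ 0 := fun s hs t ht =>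
    sin_half_sub_ne_zero (hSI s hs) (hTI t ht) fun h => hdisj t ht (h ▸ hs)
  have hsin' : ∀ t ∈ T, ∀ s ∈ S, Real.sin ((t - s) / 2) ≠ 0 := fun t ht s hs =>
    sin_half_sub_ne_zero (hTI t ht) (hSI s hs) fun h => hdisj t ht (h ▸ hs)
  have hW := eulerHess_sub_eq (f := f) (M := (M : ℂ)) hTS
    (fun s hs t ht => hinj s (hSI s hs) t (hSI t ht)) (fun s hs => by
      apply sq_dvd_of_critical
      · exact fun t ht => exp_mul_I_sub_ne_zero (hsin s hs t ht)
      · rw [← hM s hs, Complex.ofReal_sum]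
        exact Finset.sum_congr rfl fun t ht => neg_mul_div_sub_sq (hsin s hs t ht)
      · rw [Finset.sum_congr rfl fun t ht => mul_add_div_sub_cube (hsin s hs t ht),
          ← Finset.mul_sum, ← Complex.ofReal_sum, hd s hs]
        simp)
  set A : ℝ → ℝ := fun a => ∏ t ∈ T.erase a, Real.sin ((a - t) / 2) with hA
  set B : ℝ → ℝ := fun a => ∏ s ∈ S, Real.sin ((a - s) / 2) with hB
  have hB0 : ∀ a ∈ T, B a ≠ 0 := fun a ha => Finset.prod_ne_zero_iff.2 (hsin' a ha)
  -- Half-angle factorization leaves the same phase `exp (a / 2 * I) ^ T.card` in `θP` and in `R` at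
  -- `f a`. Their ratio is therefore `K / L`, independent of `a`, times the real number `A a / B a`.
  set K : ℂ := (2 * I) ^ (T.card - 1) * ∏ t ∈ T, exp (t / 2 * I) with hK
  set L : ℂ := (2 * I) ^ T.card * ∏ s ∈ S, exp (s / 2 * I) with hL
  have hK0 : K ≠ 0 := by
    refine mul_ne_zero (pow_ne_zero _ (by simp)) (Finset.prod_ne_zero_iff.2 fun _ _ =>
      Complex.exp_ne_zero _)
  have hL0 : L ≠ 0 := by
    refine mul_ne_zero (pow_ne_zero _ (by simp)) (Finset.prod_ne_zero_iff.2 fun _ _ =>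
      Complex.exp_ne_zero _)
  have hθ : ∀ a ∈ T, (eulerOp (∏ t ∈ T, (Polynomial.X - Polynomial.C (f t)))).eval (f a) =
      K * exp (a / 2 * I) ^ T.card * (A a : ℝ) := by
    intro a ha
    rw [eval_eulerOp_prod f ha]
    simp only [hf]
    rw [prod_exp_sub, hK, ← Finset.mul_prod_erase T _ ha, ← exp_half_sq a,
      Finset.card_erase_of_mem ha]
    obtain ⟨m, hm⟩ : ∃ m, T.card = m + 1 := ⟨T.card - 1, by have := hT.card_pos; omega⟩
    rw [hm, Nat.add_sub_cancel]
    ring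
  have hR : ∀ a : ℝ, (∏ s ∈ S, (Polynomial.X - Polynomial.C (f s))).eval (f a) =
      L * exp (a / 2 * I) ^ T.card * (B a : ℝ) := by
    intro a
    rw [Polynomial.eval_prod]
    simp only [Polynomial.eval_sub, Polynomial.eval_X, Polynomial.eval_C, hf]
    rw [prod_exp_sub, hL, hTS]
    ring
  have hsq : ∀ a ∈ T, (K / L) ^ 2 * ((A a / B a : ℝ) : ℂ) ^ 2 = M := by
    intro a ha
    have h := congrArg (fun p => Polynomial.eval (f a) p) hW
    have hPa : (∏ t ∈ T, (Polynomial.X - Polynomial.C (f t))).eval (f a) = 0 := by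
      rw [Polynomial.eval_prod]; exact Finset.prod_eq_zero ha (by simp)
    simp only [eulerHess, Polynomial.eval_sub, Polynomial.eval_mul, Polynomial.eval_pow,
      Polynomial.eval_neg, Polynomial.eval_C, hPa, hθ a ha, hR a] at h
    have hq := Complex.exp_ne_zero (a / 2 * I)
    have hb : (B a : ℂ) ≠ 0 := by exact_mod_cast hB0 a ha
    have h' : (exp (a / 2 * I) ^ T.card) ^ 2 * (K ^ 2 * (A a : ℂ) ^ 2) =
        (exp (a / 2 * I) ^ T.card) ^ 2 * (M * L ^ 2 * (B a : ℂ) ^ 2) := by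
      linear_combination -h
    have h'' := mul_left_cancel₀ (pow_ne_zero 2 (pow_ne_zero T.card hq)) h'
    push_cast
    field_simp
    linear_combination h''
  obtain ⟨a₀, ha₀⟩ := hT
  -- The squares agree by `hsq`; interlacing rules out opposite signs.
  have hconst : ∀ a ∈ T, A a / B a = A a₀ / B a₀ := by
    intro a ha
    have hpos : 0 < (A a * B a) * (A a₀ * B a₀) ∨ a = a₀ := by
      rcases lt_trichotomy a a₀ with h | h | h
      · exact Or.inl (prod_sin_mul_prod_sin_pos hTI hSI hdisj h1 h2 ha ha₀ h)
      · exact Or.inr h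
      · rw [mul_comm]
        exact Or.inl (prod_sin_mul_prod_sin_pos hTI hSI hdisj h1 h2 ha₀ ha h)
    rcases hpos with hpos | rfl
    · have hKL : (K / L) ^ 2 ≠ 0 := pow_ne_zero 2 (div_ne_zero hK0 hL0)
      have e := mul_left_cancel₀ hKL ((hsq a ha).trans (hsq a₀ ha₀).symm)
      have e' : (A a / B a) ^ 2 = (A a₀ / B a₀) ^ 2 := by exact_mod_cast e
      rcases sq_eq_sq_iff_eq_or_eq_neg.1 e' with e | e
      · exact e
      · exfalso
        have b1 := hB0 a ha
        have b2 := hB0 a₀ ha₀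
        have e3 : (A a * B a) * (A a₀ * B a₀) =
            (A a / B a) * (A a₀ / B a₀) * (B a * B a₀) ^ 2 := by field_simp
        rw [e3, e] at hpos
        nlinarith [mul_nonneg (sq_nonneg (A a₀ / B a₀)) (sq_nonneg (B a * B a₀))]
    · rfl
  have hfin := const_eq_of_eulerHess_eq (n := T.card) (M := M)
    (ρ := K / L * ((A a₀ / B a₀ : ℝ) : ℂ)) (Finset.card_pos.2 ⟨a₀, ha₀⟩)
    (Polynomial.monic_prod_X_sub_C f T)
    (by
      rw [Polynomial.coeff_zero_eq_eval_zero, Polynomial.eval_prod]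
      refine Finset.prod_ne_zero_iff.2 fun t _ => ?_
      simp [hf])
    (by rw [mul_pow]; exact hsq a₀ ha₀) hW
    (eulerOp_eq_of_eval_eq hTS (fun s hs t ht => hinj s (hTI s hs) t (hTI t ht)) (fun a ha => by
      rw [hθ a ha, hR a, ← hconst a ha]
      have hb : (B a : ℂ) ≠ 0 := by exact_mod_cast hB0 a ha
      push_cast
      field_simp))
  rw [← Complex.ofReal_inj, hfin]
  push_cast
  rfl

end Angles

/-! ### Perturbation of configurations. -/

section Analysis

open Filter Topology

lemma norm_exp_sub_sq (x t : ℝ) :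
    ‖(Circle.exp x : ℂ) - (Circle.exp t : ℂ)‖ ^ 2 = 2 - 2 * Real.cos (x - t) := by
  rw [Circle.coe_exp, Circle.coe_exp, Complex.sq_norm, Complex.normSq_apply, Real.cos_sub]
  simp only [Complex.sub_re, Complex.sub_im, Complex.exp_ofReal_mul_I_re,
    Complex.exp_ofReal_mul_I_im]
  linear_combination Real.sin_sq_add_cos_sq x + Real.sin_sq_add_cos_sq t

lemma continuous_circleSum {n : ℕ} :
    Continuous fun p : (Fin n → Circle) × Circle => circleSum p.1 p.2 := by
  unfold circleSum
  simp only [one_div]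
  refine continuous_finsetSum _ fun j _ => ?_
  exact (ENNReal.continuous_ofReal.comp (by fun_prop)).inv

lemma circleSum_eq_top {n : ℕ} {z : Fin n → Circle} {w : Circle} (j : Fin n) (h : w = z j) :
    circleSum z w = ⊤ := by
  rw [circleSum, ENNReal.sum_eq_top]
  exact ⟨j, Finset.mem_univ _, by simp [h]⟩

lemma circleSum_eq_ofReal {n : ℕ} {z : Fin n → Circle} {w : Circle} (h : ∀ j, w ≠ z j) :
    circleSum z w = ENNReal.ofReal (∑ j, 1 / ‖(w : ℂ) - (z j : ℂ)‖ ^ 2) := by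
  rw [circleSum, ENNReal.ofReal_sum_of_nonneg fun _ _ => by positivity]
  refine Finset.sum_congr rfl fun j _ => ?_
  have : 0 < ‖(w : ℂ) - (z j : ℂ)‖ ^ 2 := by
    have : (w : ℂ) - (z j : ℂ) ≠ 0 := sub_ne_zero.2 fun e => h j (Circle.ext e)
    positivity
  rw [ENNReal.ofReal_div_of_pos this, ENNReal.ofReal_one]

lemma exp_eq_exp_of_cos_eq_one {x t : ℝ} (h : Real.cos (x - t) = 1) :
    Circle.exp x = Circle.exp t := by
  have := norm_exp_sub_sq x t
  rw [h] at this
  apply Circle.ext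
  rw [← sub_eq_zero, ← norm_eq_zero, ← sq_eq_zero_iff, this]
  norm_num

lemma circleSum_exp {n : ℕ} {t : Fin n → ℝ} {x : ℝ} (h : ∀ j, Real.cos (x - t j) ≠ 1) :
    circleSum (fun j => Circle.exp (t j)) (Circle.exp x) =
      ENNReal.ofReal (∑ j, 1 / (2 - 2 * Real.cos (x - t j))) := by
  rw [circleSum_eq_ofReal fun j e => h j ?_]
  · simp only [norm_exp_sub_sq]
  · have := norm_exp_sub_sq x (t j)
    rw [e, sub_self, norm_zero] at this
    linarith

lemma two_sub_two_cos_pos {u : ℝ} (h : Real.cos u ≠ 1) : 0 < 2 - 2 * Real.cos u := by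
  linarith [lt_of_le_of_ne (Real.cos_le_one u) h]

lemma exists_circleSum_eq_circleMin {n : ℕ} (z : Fin n → Circle) :
    ∃ w, circleSum z w = circleMin z := by
  obtain ⟨w, -, hw⟩ := (isCompact_univ (X := Circle)).exists_isMinOn Set.univ_nonempty
    (f := circleSum z)
    (continuous_circleSum.comp (Continuous.prodMk_right z)).continuousOn
  exact ⟨w, le_antisymm (le_iInf fun w' => hw (Set.mem_univ w')) (iInf_le _ w)⟩

/-- If moving the points in the direction `δ` increases `circleSum` near each minimizer, then
the configuration is not locally extremal. -/
lemma not_locallyExtremal_of_perturbation {n : ℕ} (t δ : Fin n → ℝ)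
    (h : ∀ s : ℝ, circleSum (fun j => Circle.exp (t j)) (Circle.exp s) =
      circleMin (fun j => Circle.exp (t j)) → ∀ᶠ p : ℝ × ℝ in 𝓝 (0, s), 0 < p.1 →
        circleSum (fun j => Circle.exp (t j)) (Circle.exp p.2) <
          circleSum (fun j => Circle.exp (t j + p.1 * δ j)) (Circle.exp p.2)) :
    ¬ LocallyExtremal (fun j => Circle.exp (t j)) := by
  rintro ⟨U, hU, hmax⟩
  set z : Fin n → Circle := fun j => Circle.exp (t j) with hz
  have hcont : Continuous fun p : ℝ × ℝ =>
      circleSum (fun j => Circle.exp (t j + p.1 * δ j)) (Circle.exp p.2) :=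
    continuous_circleSum.comp (f := fun p : ℝ × ℝ =>
      ((fun j => Circle.exp (t j + p.1 * δ j)), Circle.exp p.2)) (by fun_prop)
  -- Near minimizers the hypothesis applies; elsewhere the strict inequality at `ε = 0` persists by
  -- continuity. Compactness then gives one `ε` for all angles.
  have h1 : ∀ s ∈ Set.Icc (-Real.pi) Real.pi, ∀ᶠ p : ℝ × ℝ in 𝓝 (0, s), 0 < p.1 →
      circleMin z < circleSum (fun j => Circle.exp (t j + p.1 * δ j)) (Circle.exp p.2) := by
    intro s _
    by_cases hs : circleSum z (Circle.exp s) = circleMin z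
    · filter_upwards [h s hs] with p hp hp0
      exact (iInf_le _ _).trans_lt (hp hp0)
    · have hlt : circleMin z < circleSum z (Circle.exp s) :=
        lt_of_le_of_ne (iInf_le _ _) (Ne.symm hs)
      have := hcont.continuousAt (x := ((0 : ℝ), s))
      have hev := this.eventually (lt_mem_nhds (a := circleMin z) (by simpa [hz] using hlt))
      filter_upwards [hev] with p hp _ using hp
  have h2 := isCompact_Icc.eventually_forall_of_forall_eventually (x₀ := (0 : ℝ))
    (P := fun ε x => 0 < ε →
      circleMin z < circleSum (fun j => Circle.exp (t j + ε * δ j)) (Circle.exp x)) (by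
      intro s hs; simpa only [nhds_prod_eq] using h1 s hs)
  have h3 : ∀ᶠ ε : ℝ in 𝓝 0, (fun j => Circle.exp (t j + ε * δ j)) ∈ U := by
    have hc : Continuous fun ε : ℝ => (fun j => Circle.exp (t j + ε * δ j)) := by fun_prop
    exact hc.continuousAt.eventually_mem (by simpa [hz] using hU)
  obtain ⟨ε, ⟨hε2, hε3⟩, hε⟩ :=
    (((h2.and h3).filter_mono nhdsWithin_le_nhds).and
      (self_mem_nhdsWithin (s := Set.Ioi (0 : ℝ)))).exists
  obtain ⟨w, hw⟩ := exists_circleSum_eq_circleMin fun j => Circle.exp (t j + ε * δ j)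
  have h4 := hε2 (Complex.arg w) (Set.Ioc_subset_Icc_self (Complex.arg_mem_Ioc _)) hε
  rw [Circle.exp_arg, hw] at h4
  exact (hmax _ hε3).not_gt h4

lemma hasDerivAt_kernel {u : ℝ} (h : Real.cos u ≠ 1) :
    HasDerivAt (fun u => 1 / (2 - 2 * Real.cos u)) (-(1 / 2) * kernelSlope u) u := by
  have h0 := (two_sub_two_cos_pos h).ne'
  have h1 : 1 - Real.cos u ≠ 0 := fun e => h0 (by linarith)
  have := (((Real.hasDerivAt_cos u).const_mul 2).const_sub 2).inv h0
  simp only [one_div]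
  refine this.congr_deriv ?_
  rw [kernelSlope, show 2 - 2 * Real.cos u = 2 * (1 - Real.cos u) by ring]
  field_simp

lemma continuousAt_kernelSlope {u : ℝ} (h : Real.cos u ≠ 1) : ContinuousAt kernelSlope u := by
  unfold kernelSlope
  exact Real.continuous_sin.continuousAt.div (by fun_prop)
    (pow_ne_zero 2 fun e => h (by linarith))

/-- The `ε`-derivative of the sum is half the slope sum, hence positive on a whole neighbourhood of
`(0, s)`. Integrating along the segment at fixed angle `p.2` gives an inequality uniform in that
angle. -/
lemma eventually_lt_of_slope_pos {n : ℕ} {t δ : Fin n → ℝ} {s : ℝ}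
    (hs : ∀ j, Real.cos (s - t j) ≠ 1) (hpos : 0 < ∑ j, δ j * kernelSlope (s - t j)) :
    ∀ᶠ p : ℝ × ℝ in 𝓝 (0, s), 0 < p.1 →
      circleSum (fun j => Circle.exp (t j)) (Circle.exp p.2) <
        circleSum (fun j => Circle.exp (t j + p.1 * δ j)) (Circle.exp p.2) := by
  have h1 : ∀ᶠ p : ℝ × ℝ in 𝓝 (0, s), (∀ j, Real.cos (p.2 - (t j + p.1 * δ j)) ≠ 1) ∧
      0 < ∑ j, δ j * kernelSlope (p.2 - (t j + p.1 * δ j)) := by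
    refine (eventually_all.2 fun j => ?_).and ?_
    · exact ContinuousAt.eventually_ne (by fun_prop) (by simpa using hs j)
    · have : ContinuousAt (fun p : ℝ × ℝ =>
          ∑ j, δ j * kernelSlope (p.2 - (t j + p.1 * δ j))) (0, s) := by
        refine tendsto_finsetSum _ fun j _ => ?_
        refine ContinuousAt.mul continuousAt_const ?_
        exact ContinuousAt.comp (g := kernelSlope)
          (continuousAt_kernelSlope (by simpa using hs j)) (by fun_prop)
      exact this.eventually (lt_mem_nhds (by simpa using hpos))
  obtain ⟨r, hr, hball⟩ := Metric.eventually_nhds_iff.1 h1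
  refine Metric.eventually_nhds_iff.2 ⟨r, hr, fun {p} hp hp0 => ?_⟩
  have hseg : ∀ ε ∈ Set.Icc 0 p.1, (∀ j, Real.cos (p.2 - (t j + ε * δ j)) ≠ 1) ∧
      0 < ∑ j, δ j * kernelSlope (p.2 - (t j + ε * δ j)) := by
    intro ε hε
    refine hball (y := (ε, p.2)) ?_
    rw [Prod.dist_eq, max_lt_iff] at hp ⊢
    refine ⟨?_, hp.2⟩
    have := hp.1
    simp only [Real.dist_eq, sub_zero] at this ⊢
    rw [abs_of_nonneg hε.1]
    rw [abs_of_pos hp0] at this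
    exact hε.2.trans_lt this
  have hder : ∀ ε ∈ Set.Icc 0 p.1, HasDerivAt
      (fun ε => ∑ j, 1 / (2 - 2 * Real.cos (p.2 - (t j + ε * δ j))))
      (1 / 2 * ∑ j, δ j * kernelSlope (p.2 - (t j + ε * δ j))) ε := by
    intro ε hε
    rw [Finset.mul_sum]
    refine HasDerivAt.fun_sum fun j _ => ?_
    have hi : HasDerivAt (fun ε => p.2 - (t j + ε * δ j)) (-δ j) ε := by
      simpa using (((hasDerivAt_id ε).mul_const (δ j)).const_add (t j)).const_sub p.2
    refine (HasDerivAt.comp ε (hasDerivAt_kernel ((hseg ε hε).1 j)) hi).congr_deriv ?_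
    ring
  have hmono : StrictMonoOn (fun ε => ∑ j, 1 / (2 - 2 * Real.cos (p.2 - (t j + ε * δ j))))
      (Set.Icc 0 p.1) := by
    apply strictMonoOn_of_deriv_pos (convex_Icc _ _)
    · exact fun ε hε => (hder ε hε).continuousAt.continuousWithinAt
    · intro ε hε
      have hε' := interior_subset hε
      rw [(hder ε hε').deriv]
      linarith [(hseg ε hε').2]
  have hlt := hmono (Set.left_mem_Icc.2 hp0.le) (Set.right_mem_Icc.2 hp0.le) hp0
  have h0 := (hseg 0 (Set.left_mem_Icc.2 hp0.le)).1
  simp only [zero_mul, add_zero] at h0 hlt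
  rw [circleSum_exp h0, circleSum_exp (hseg p.1 (Set.right_mem_Icc.2 hp0.le)).1]
  exact (ENNReal.ofReal_lt_ofReal_iff_of_nonneg
    (Finset.sum_nonneg fun j _ => (one_div_pos.2 (two_sub_two_cos_pos (h0 j))).le)).2 hlt

/-- Strict midpoint convexity of `u ↦ 1 / (2 - 2 cos u)` away from its poles. -/
lemma two_mul_kernel_lt {u ε : ℝ} (h1 : Real.cos (u + ε) ≠ 1) (h2 : Real.cos (u - ε) ≠ 1)
    (h3 : Real.cos u < Real.cos ε) (h4 : Real.cos ε < 1) :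
    2 * (1 / (2 - 2 * Real.cos u)) <
      1 / (2 - 2 * Real.cos (u + ε)) + 1 / (2 - 2 * Real.cos (u - ε)) := by
  have p1 := two_sub_two_cos_pos h1
  have p2 := two_sub_two_cos_pos h2
  have p0 := two_sub_two_cos_pos (h3.trans h4).ne
  rw [div_add_div _ _ p1.ne' p2.ne', mul_one_div, div_lt_div_iff₀ p0 (mul_pos p1 p2)]
  rw [Real.cos_add, Real.cos_sub]
  have s1 := Real.sin_sq_add_cos_sq u
  have s2 := Real.sin_sq_add_cos_sq ε
  have hb := Real.neg_one_le_cos u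
  set c := Real.cos u
  set e := Real.cos ε
  set a := Real.sin u
  set b := Real.sin ε
  -- As `(1 - cos (u + ε)) (1 - cos (u - ε)) = (e - c)²`, the claim reduces to `(e - c)² < (1 - c)
  -- (1 - c e)`; `key` is the difference of the two sides.
  have key : 0 < (1 - e) * ((1 - c) * (2 + c) - (1 - e)) := by
    apply mul_pos (by linarith)
    nlinarith
  have hab : a ^ 2 * b ^ 2 = (1 - c ^ 2) * (1 - e ^ 2) := by
    rw [show a ^ 2 = 1 - c ^ 2 by linarith, show b ^ 2 = 1 - e ^ 2 by linarith]
  nlinarith [key, hab]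

lemma not_locallyExtremal_of_eq {n : ℕ} {t : Fin n → ℝ} {a b : Fin n} (hab : a ≠ b)
    (ht : t a = t b) (hfin : circleMin (fun j => Circle.exp (t j)) ≠ ⊤) :
    ¬ LocallyExtremal (fun j => Circle.exp (t j)) := by
  classical
  -- Opposite motions cancel to first order, leaving the strict convexity gain.
  set δ : Fin n → ℝ := fun j => if j = a then -1 else if j = b then 1 else 0 with hδ
  have hδa : δ a = -1 := by simp [hδ]
  have hδb : δ b = 1 := by simp [hδ, hab.symm]
  have hδj : ∀ j, j ≠ a ∧ j ≠ b → δ j = 0 := fun j hj => by simp [hδ, hj.1, hj.2]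
  refine not_locallyExtremal_of_perturbation t δ fun s hs => ?_
  have hpole : ∀ j, Real.cos (s - t j) ≠ 1 := by
    intro j hj
    rw [circleSum_eq_top j (exp_eq_exp_of_cos_eq_one hj)] at hs
    exact hfin hs.symm
  have e1 : ∀ᶠ p : ℝ × ℝ in 𝓝 (0, s), ∀ j, Real.cos (p.2 - (t j + p.1 * δ j)) ≠ 1 :=
    eventually_all.2 fun j => ContinuousAt.eventually_ne (by fun_prop) (by simpa using hpole j)
  have e2 : ∀ᶠ p : ℝ × ℝ in 𝓝 (0, s), ∀ j, Real.cos (p.2 - t j) ≠ 1 :=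
    eventually_all.2 fun j => ContinuousAt.eventually_ne (by fun_prop) (by simpa using hpole j)
  have e3 : ∀ᶠ p : ℝ × ℝ in 𝓝 (0, s), Real.cos (p.2 - t a) < Real.cos p.1 :=
    ContinuousAt.eventually_lt (by fun_prop) (by fun_prop)
      (by simpa using lt_of_le_of_ne (Real.cos_le_one _) (hpole a))
  have e4 : ∀ᶠ p : ℝ × ℝ in 𝓝 (0, s), p.1 < 1 :=
    ContinuousAt.eventually_lt (by fun_prop) (by fun_prop) (by simp)
  filter_upwards [e1, e2, e3, e4] with p h1 h2 h3 h4 hp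
  rw [circleSum_exp h1, circleSum_exp h2]
  refine (ENNReal.ofReal_lt_ofReal_iff_of_nonneg
    (Finset.sum_nonneg fun j _ => (one_div_pos.2 (two_sub_two_cos_pos (h2 j))).le)).2 ?_
  rw [← sub_pos, ← Finset.sum_sub_distrib, Fintype.sum_eq_add a b hab fun j hj => by
    simp [hδj j hj]]
  have ha : p.2 - (t a + p.1 * δ a) = p.2 - t a + p.1 := by rw [hδa]; ring
  have hb : p.2 - (t b + p.1 * δ b) = p.2 - t a - p.1 := by rw [hδb, ht]; ring
  have q1 := h1 a
  have q2 := h1 b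
  rw [ha] at q1
  rw [hb] at q2
  have hc : Real.cos p.1 < 1 := by
    rw [← Real.cos_zero]
    exact Real.cos_lt_cos_of_nonneg_of_le_pi le_rfl (by linarith [Real.pi_gt_three]) hp
  have := two_mul_kernel_lt q1 q2 h3 hc
  rw [ha, hb, ← ht]
  linarith

/-- Gordan's alternative. -/
lemma exists_pos_functional_or_exists_weights {ι κ : Type*} [Fintype ι] [Fintype κ]
    (v : ι → κ → ℝ) : (∃ δ : κ → ℝ, ∀ i, 0 < ∑ k, δ k * v i k) ∨
      ∃ c : ι → ℝ, (∀ i, 0 ≤ c i) ∧ ∑ i, c i = 1 ∧ ∀ k, ∑ i, c i * v i k = 0 := by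
  classical
  let L : (ι → ℝ) →ₗ[ℝ] (κ → ℝ) := Fintype.linearCombination ℝ v
  have hL : ∀ c, L c = ∑ i, c i • v i := fun c => Fintype.linearCombination_apply ℝ v c
  -- The image of the simplex is the convex hull of the `v i`: it either contains `0` or is strictly
  -- separated from it.
  by_cases h0 : (0 : κ → ℝ) ∈ L '' stdSimplex ℝ ι
  · right
    obtain ⟨c, hc, hc0⟩ := h0
    refine ⟨c, hc.1, hc.2, fun k => ?_⟩
    have := congrFun ((hL c).symm.trans hc0) k
    simpa using this
  · left
    have hcl : IsClosed (L '' stdSimplex ℝ ι) :=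
      ((isCompact_stdSimplex ℝ ι).image L.continuous_of_finiteDimensional).isClosed
    obtain ⟨f, u, hu, hf⟩ := geometric_hahn_banach_point_closed
      ((convex_stdSimplex ℝ ι).linear_image L) hcl h0
    refine ⟨fun k => f (Pi.single k 1), fun i => ?_⟩
    have h1 := hf (v i) ⟨Pi.single i 1, single_mem_stdSimplex ℝ i, by
      rw [hL, Finset.sum_eq_single i] <;> simp +contextual⟩
    rw [map_zero] at hu
    have h2 : f (v i) = ∑ k, f (Pi.single k 1) * v i k := by
      conv_lhs => rw [pi_eq_sum_univ' (v i), map_sum]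
      refine Finset.sum_congr rfl fun k _ => ?_
      rw [map_smul, smul_eq_mul, mul_comm]
    linarith

end Analysis

/-! ### Locally extremal configurations and consequences. -/

section Extremal

open Filter Topology

lemma circleMin_ne_top {n : ℕ} (t : Fin n → ℝ)
    (htI : ∀ j, t j ∈ Set.Ioc (-Real.pi) Real.pi) :
    circleMin (fun j => Circle.exp (t j)) ≠ ⊤ := by
  obtain ⟨x, hx, hxT⟩ := (Set.Ioc_infinite (by linarith [Real.pi_pos] :
    -Real.pi < Real.pi)).exists_notMem_finset (Finset.univ.image t)
  refine ((iInf_le _ (Circle.exp x)).trans_lt ?_).ne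
  rw [circleSum_exp fun j hj => ?_]
  · exact ENNReal.ofReal_lt_top
  · refine sin_half_sub_ne_zero hx (htI j)
      (fun h => hxT (Finset.mem_image.2 ⟨j, Finset.mem_univ _, h.symm⟩)) ?_
    have := one_sub_cos_eq (x - t j)
    rw [hj] at this
    exact pow_eq_zero_iff two_ne_zero |>.1 (by linarith)

section Minimizers

variable {n : ℕ} {t : Fin n → ℝ} {s : ℝ}

lemma cos_ne_one_of_minimizer (hfin : circleMin (fun j => Circle.exp (t j)) ≠ ⊤)
    (hs : circleSum (fun j => Circle.exp (t j)) (Circle.exp s) =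
      circleMin (fun j => Circle.exp (t j))) (j : Fin n) : Real.cos (s - t j) ≠ 1 := by
  intro hj
  rw [circleSum_eq_top j (exp_eq_exp_of_cos_eq_one hj)] at hs
  exact hfin hs.symm

lemma sum_eq_of_minimizer (hfin : circleMin (fun j => Circle.exp (t j)) ≠ ⊤)
    (hs : circleSum (fun j => Circle.exp (t j)) (Circle.exp s) =
      circleMin (fun j => Circle.exp (t j))) :
    ∑ j, 1 / (2 - 2 * Real.cos (s - t j)) = (circleMin (fun j => Circle.exp (t j))).toReal := by
  have h := cos_ne_one_of_minimizer hfin hs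
  rw [← hs, circleSum_exp h, ENNReal.toReal_ofReal]
  exact Finset.sum_nonneg fun j _ => (one_div_pos.2 (two_sub_two_cos_pos (h j))).le

lemma sum_kernelSlope_eq_zero_of_minimizer
    (hfin : circleMin (fun j => Circle.exp (t j)) ≠ ⊤)
    (hs : circleSum (fun j => Circle.exp (t j)) (Circle.exp s) =
      circleMin (fun j => Circle.exp (t j))) : ∑ j, kernelSlope (s - t j) = 0 := by
  have h := cos_ne_one_of_minimizer hfin hs
  have hmin : IsLocalMin (fun x => ∑ j, 1 / (2 - 2 * Real.cos (x - t j))) s := by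
    have hev : ∀ᶠ x in 𝓝 s, ∀ j, Real.cos (x - t j) ≠ 1 :=
      eventually_all.2 fun j => ContinuousAt.eventually_ne (by fun_prop) (h j)
    filter_upwards [hev] with x hx
    rw [sum_eq_of_minimizer hfin hs]
    refine ENNReal.toReal_le_of_le_ofReal
      (Finset.sum_nonneg fun j _ => (one_div_pos.2 (two_sub_two_cos_pos (hx j))).le) ?_
    rw [← circleSum_exp hx]
    exact iInf_le _ _
  have hder : HasDerivAt (fun x => ∑ j, 1 / (2 - 2 * Real.cos (x - t j)))
      (∑ j, -(1 / 2) * kernelSlope (s - t j)) s :=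
    HasDerivAt.fun_sum fun j _ => HasDerivAt.comp_sub_const s (t j) (hasDerivAt_kernel (h j))
  have := hmin.hasDerivAt_eq_zero hder
  rw [← Finset.mul_sum] at this
  linarith

end Minimizers

/-- At a locally extremal configuration the minimum is `n² / 4`. -/
theorem toReal_circleMin_of_locallyExtremal {n : ℕ} (hn : 0 < n) {t : Fin n → ℝ}
    (htI : ∀ j, t j ∈ Set.Ioc (-Real.pi) Real.pi)
    (hext : LocallyExtremal (fun j => Circle.exp (t j))) :
    (circleMin (fun j => Circle.exp (t j))).toReal = (n : ℝ) ^ 2 / 4 := by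
  classical
  have hfin := circleMin_ne_top t htI
  have htinj : Function.Injective t := by
    intro a b hab
    by_contra hne
    exact not_locallyExtremal_of_eq hne hab hfin hext
  set z : Fin n → Circle := fun j => Circle.exp (t j) with hz
  set T : Finset ℝ := Finset.univ.image t with hT
  have hTcard : T.card = n := by
    rw [hT, Finset.card_image_of_injective _ htinj, Finset.card_univ, Fintype.card_fin]
  have hTne : T.Nonempty := Finset.card_pos.1 (hTcard ▸ hn)
  have hTI : ∀ p ∈ T, p ∈ Set.Ioc (-Real.pi) Real.pi := by
    intro p hp
    obtain ⟨j, -, rfl⟩ := Finset.mem_image.1 hp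
    exact htI j
  have hTsum : ∀ g : ℝ → ℝ, ∑ p ∈ T, g p = ∑ j, g (t j) := fun g =>
    Finset.sum_image fun a _ b _ h => htinj h
  set S : Set ℝ := {s | s ∈ Set.Ioc (-Real.pi) Real.pi ∧
    circleSum z (Circle.exp s) = circleMin z} with hS
  have hTS : ∀ p ∈ T, p ∉ S := by
    intro p hp hpS
    obtain ⟨j, -, rfl⟩ := Finset.mem_image.1 hp
    exact cos_ne_one_of_minimizer hfin hpS.2 j (by simp)
  have hcrit : ∀ s ∈ S, ∑ p ∈ T, (1 : ℝ) * kernelSlope (s - p) = 0 := by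
    intro s hs
    simp only [one_mul]
    rw [hTsum fun p => kernelSlope (s - p)]
    exact sum_kernelSlope_eq_zero_of_minimizer hfin hs.2
  -- Minimizers are critical points of the sum with poles `T`. Stating the bound for finite subsets
  -- also yields finiteness of `S`.
  have hSle : ∀ U : Finset ℝ, (∀ s ∈ U, s ∈ S) → U.card ≤ n := by
    intro U hU
    rw [← hTcard]
    exact card_zeros_le_card_poles hTne (c := fun _ => 1) (fun _ _ => one_pos) hTI
      (fun s hs => (hU s hs).1) (fun p hp h => hTS p hp (hU p h)) (fun s hs => hcrit s (hU s hs))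
  have hSfin : S.Finite := by
    by_contra hinf
    obtain ⟨U, hU, hUc⟩ := Set.Infinite.exists_subset_card_eq hinf (n + 1)
    have := hSle U hU
    omega
  set F : Finset ℝ := hSfin.toFinset with hF
  have hFS : ∀ {s}, s ∈ F ↔ s ∈ S := hSfin.mem_toFinset
  have hTF : ∀ p ∈ T, p ∉ F := fun p hp h => hTS p hp (hFS.1 h)
  have hFI : ∀ p ∈ F, p ∈ Set.Ioc (-Real.pi) Real.pi := fun p hp => (hFS.1 hp).1
  rcases exists_pos_functional_or_exists_weights
    (fun (s : F) (j : Fin n) => kernelSlope (s - t j)) with ⟨δ, hδ⟩ | ⟨c, hc0, hc1, hc⟩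
  · exfalso
    refine not_locallyExtremal_of_perturbation t δ (fun s hs => ?_) hext
    -- `s` is an arbitrary real angle, while `F` holds only representatives in `(-π, π]`.
    have hs' : Complex.arg (Circle.exp s) ∈ F := by
      rw [hFS]
      exact ⟨Complex.arg_mem_Ioc _, by rw [Circle.exp_arg]; exact hs⟩
    have hcong : ∀ j, kernelSlope (s - t j) =
        kernelSlope (Complex.arg (Circle.exp s) - t j) := by
      intro j
      obtain ⟨m, hm⟩ := Circle.exp_eq_exp.1 (Circle.exp_arg (Circle.exp s))
      rw [hm]
      have e : s + m * (2 * Real.pi) - t j = s - t j + m * (2 * Real.pi) := by ring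
      rw [e, kernelSlope, kernelSlope, Real.sin_add_int_mul_two_pi, Real.cos_add_int_mul_two_pi]
    refine eventually_lt_of_slope_pos (cos_ne_one_of_minimizer hfin hs) ?_
    simp only [hcong]
    exact hδ ⟨_, hs'⟩
  · set d : ℝ → ℝ := fun p => if h : p ∈ F then c ⟨p, h⟩ else 0 with hd
    have hdF : ∀ p : F, d p = c p := fun p => by simp [hd]
    -- Zero weights are discarded because the zero count needs strictly positive coefficients.
    set P : Finset ℝ := F.filter fun p => 0 < d p with hP
    have hPF : ∀ p ∈ P, p ∈ F := fun p hp => (Finset.mem_filter.1 hp).1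
    have hPsum : ∀ g : ℝ → ℝ, ∑ p ∈ P, d p * g p = ∑ p : F, c p * g p := by
      intro g
      rw [hP, Finset.sum_filter_of_ne, ← Finset.sum_coe_sort]
      · simp only [hdF]
      · intro p hp hne
        have h0 : 0 ≤ d p := by rw [hdF ⟨p, hp⟩]; exact hc0 _
        exact lt_of_le_of_ne h0 (left_ne_zero_of_mul hne).symm
    have hPne : P.Nonempty := by
      rw [Finset.nonempty_iff_ne_empty]
      intro hem
      have := hPsum fun _ => 1
      simp only [hem, Finset.sum_empty, mul_one, hc1] at this
      exact zero_ne_one this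
    -- The roles are exchanged: the slope is odd, so the points of `T` become critical points and
    -- the minimizers in `P` become poles.
    have hPz : ∀ a ∈ T, ∑ p ∈ P, d p * kernelSlope (a - p) = 0 := by
      intro a ha
      obtain ⟨j, -, rfl⟩ := Finset.mem_image.1 ha
      rw [hPsum fun p => kernelSlope (t j - p), ← neg_eq_zero, ← hc j, ← Finset.sum_neg_distrib]
      refine Finset.sum_congr rfl fun p _ => ?_
      rw [← neg_sub (p : ℝ) (t j), kernelSlope_neg]
      ring
    have hPpos : ∀ p ∈ P, 0 < d p := fun p hp => (Finset.mem_filter.1 hp).2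
    have hPI := fun p hp => hFI p (hPF p hp)
    have hPT : ∀ p ∈ P, p ∉ T := fun p hp h => hTF p h (hPF p hp)
    have hle : n ≤ P.card := by
      rw [← hTcard]
      exact card_zeros_le_card_poles hPne hPpos hPI hTI hPT hPz
    have hFcard : F.card = n := le_antisymm (hSle F fun s hs => hFS.1 hs)
      (hle.trans (Finset.card_le_card (Finset.filter_subset _ _)))
    suffices h : (circleMin z).toReal = (T.card : ℝ) ^ 2 / 4 by rw [h, hTcard]
    refine value_eq_card_sq_div_four hTne (hTcard.trans hFcard.symm) hTI hFI hTF ?_ ?_ ?_ ?_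
    · intro a ha a' ha' haa
      obtain ⟨p, hp, h⟩ := exists_pole_between hPne hPpos hPI hTI hPT hPz ha ha' haa
      exact ⟨p, hPF p hp, h⟩
    · intro a ha a' ha' haa
      exact exists_pole_between hTne (c := fun _ => 1) (fun _ _ => one_pos) hTI hFI hTF
        (fun s hs => hcrit s (hFS.1 hs)) ha ha' haa
    · intro s hs
      rw [hTsum fun p => 1 / (2 - 2 * Real.cos (s - p))]
      exact sum_eq_of_minimizer hfin (hFS.1 hs).2
    · intro s hs
      simpa using hcrit s (hFS.1 hs)

theorem circleMin_of_locallyExtremal {n : ℕ} {z : Fin n → Circle} (hz : LocallyExtremal z) :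
    circleMin z = (n : ℝ≥0∞) ^ 2 / 4 := by
  rcases n.eq_zero_or_pos with rfl | hn
  · simp [circleMin, circleSum]
  have hzt : z = fun j => Circle.exp (Complex.arg (z j)) := by
    funext j; rw [Circle.exp_arg]
  have htI : ∀ j, Complex.arg (z j) ∈ Set.Ioc (-Real.pi) Real.pi :=
    fun j => Complex.arg_mem_Ioc _
  rw [hzt] at hz ⊢
  rw [← ENNReal.ofReal_toReal (circleMin_ne_top _ htI),
    toReal_circleMin_of_locallyExtremal hn htI hz, ENNReal.ofReal_div_of_pos (by norm_num),
    ENNReal.ofReal_pow (by positivity), ENNReal.ofReal_natCast]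
  norm_num

/-- An infimum of continuous functions is upper semicontinuous, so it attains its maximum on the
compact torus. -/
lemma exists_locallyExtremal (n : ℕ) :
    ∃ z : Fin n → Circle, LocallyExtremal z ∧ ∀ z' : Fin n → Circle, circleMin z' ≤ circleMin z := by
  have husc : UpperSemicontinuous fun z : Fin n → Circle => circleMin z :=
    upperSemicontinuous_iInf fun w =>
      (continuous_circleSum.comp (Continuous.prodMk_left w)).upperSemicontinuous
  obtain ⟨z, -, hz⟩ := UpperSemicontinuousOn.exists_isMaxOn Set.univ_nonempty
    (isCompact_univ (X := Fin n → Circle)) (husc.upperSemicontinuousOn _)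
  exact ⟨z, ⟨Set.univ, univ_mem, fun z' _ => hz (Set.mem_univ z')⟩,
    fun z' => hz (Set.mem_univ z')⟩

theorem exists_sum_one_div_norm_sub_sq_le {n : ℕ} (z : Fin n → Circle) :
    ∃ w : Circle, (∀ j, w ≠ z j) ∧
      ∑ j, 1 / ‖(w : ℂ) - (z j : ℂ)‖ ^ 2 ≤ (n : ℝ) ^ 2 / 4 := by
  obtain ⟨z₀, hz₀, hmax⟩ := exists_locallyExtremal n
  obtain ⟨w, hw⟩ := exists_circleSum_eq_circleMin z
  have e : (n : ℝ≥0∞) ^ 2 / 4 = ENNReal.ofReal ((n : ℝ) ^ 2 / 4) := by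
    rw [ENNReal.ofReal_div_of_pos (by norm_num), ENNReal.ofReal_pow (by positivity),
      ENNReal.ofReal_natCast]
    norm_num
  have hle : circleSum z w ≤ ENNReal.ofReal ((n : ℝ) ^ 2 / 4) := by
    rw [hw, ← e, ← circleMin_of_locallyExtremal hz₀]
    exact hmax z
  have hne : ∀ j, w ≠ z j := by
    intro j hj
    rw [circleSum_eq_top j hj] at hle
    exact ENNReal.ofReal_ne_top (top_le_iff.1 hle)
  refine ⟨w, hne, ?_⟩
  rw [circleSum_eq_ofReal hne] at hle
  exact (ENNReal.ofReal_le_ofReal_iff (by positivity)).1 hle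

theorem exists_sum_one_div_inner_sq_le {n : ℕ} (u : Fin n → EuclideanSpace ℝ (Fin 2))
    (hu : ∀ i, ‖u i‖ = 1) :
    ∃ v : EuclideanSpace ℝ (Fin 2), ‖v‖ = 1 ∧ (∀ i, inner ℝ (u i) v ≠ 0) ∧
      ∑ i, 1 / (inner ℝ (u i) v) ^ 2 ≤ (n : ℝ) ^ 2 := by
  have hu' : ∀ i, u i 0 ^ 2 + u i 1 ^ 2 = 1 := by
    intro i
    have := EuclideanSpace.real_norm_sq_eq (u i)
    rw [hu i, Fin.sum_univ_two] at this
    linarith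
  let ζ : Fin n → Circle := fun i => ⟨⟨u i 0, u i 1⟩, by
    rw [Submonoid.unitSphere, Submonoid.mem_mk]
    simp [Complex.norm_def, Complex.normSq_apply, ← sq, hu' i]⟩
  have hζ : ∀ i, ((ζ i : Circle) : ℂ) = ⟨u i 0, u i 1⟩ := fun i => rfl
  -- Squaring identifies `u` with `-u`, as does `⟨u, v⟩²`. With `w = exp (2iθ)` and `v` orthogonal
  -- to `exp (iθ)`, one gets `|w - ζ²| = 2 |⟨u, v⟩|`.
  obtain ⟨w, hw, hsum⟩ := exists_sum_one_div_norm_sub_sq_le fun i => ζ i ^ 2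
  set θ := Complex.arg w / 2 with hθ
  have hwθ : w = Circle.exp (2 * θ) := by
    rw [hθ, mul_div_cancel₀ _ two_ne_zero, Circle.exp_arg]
  set v : EuclideanSpace ℝ (Fin 2) := !₂[-Real.sin θ, Real.cos θ] with hv
  have hinner : ∀ i, inner ℝ (u i) v = u i 1 * Real.cos θ - u i 0 * Real.sin θ := by
    intro i
    rw [PiLp.inner_apply, Fin.sum_univ_two]
    simp [hv]
    ring
  have hnorm : ∀ i, ‖(w : ℂ) - ((ζ i ^ 2 : Circle) : ℂ)‖ ^ 2 = 4 * inner ℝ (u i) v ^ 2 := by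
    intro i
    rw [hinner, hwθ, Circle.coe_pow, hζ, Circle.coe_exp, Complex.sq_norm, Complex.normSq_apply,
      Complex.sub_re, Complex.sub_im, Complex.exp_ofReal_mul_I_re, Complex.exp_ofReal_mul_I_im,
      sq (Complex.mk _ _), Complex.mul_re, Complex.mul_im, Real.cos_two_mul, Real.sin_two_mul]
    have h1 := hu' i
    have h2 := Real.sin_sq_add_cos_sq θ
    set x := u i 0
    set y := u i 1
    set a := Real.sin θ
    set b := Real.cos θ
    rw [show 2 * b ^ 2 - 1 = b ^ 2 - a ^ 2 by linarith]
    linear_combination (a ^ 2 + b ^ 2 - (x ^ 2 + y ^ 2)) * (h2 - h1)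
  refine ⟨v, ?_, fun i hi => ?_, ?_⟩
  · rw [EuclideanSpace.norm_eq, Fin.sum_univ_two]
    simp [hv]
  · have := hnorm i
    rw [hi] at this
    refine hw i (Circle.ext ?_)
    rw [← sub_eq_zero, ← norm_eq_zero, ← sq_eq_zero_iff, this]
    norm_num
  · simp only [hnorm] at hsum
    have e : ∀ i, 1 / (4 * inner ℝ (u i) v ^ 2) = 1 / 4 * (1 / inner ℝ (u i) v ^ 2) := by
      intro i; rw [one_div_mul_one_div]
    simp only [e, ← Finset.mul_sum] at hsum
    linarith

end Extremal

theorem mainTheorem3 (n : ℕ) :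
    (∀ z : Fin n → Circle, ∃ w : Circle, (∀ j, w ≠ z j) ∧
      ∑ j, 1 / ‖(w : ℂ) - (z j : ℂ)‖ ^ 2 ≤ (n : ℝ) ^ 2 / 4) ∧
    (∀ u : Fin n → EuclideanSpace ℝ (Fin 2), (∀ i, ‖u i‖ = 1) →
      ∃ v : EuclideanSpace ℝ (Fin 2), ‖v‖ = 1 ∧ (∀ i, inner ℝ (u i) v ≠ 0) ∧
        ∑ i, 1 / (inner ℝ (u i) v) ^ 2 ≤ (n : ℝ) ^ 2) ∧
    (∀ z : Fin n → Circle, LocallyExtremal z →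
      circleMin z = (n : ℝ≥0∞) ^ 2 / 4 ∧
        ∃ w : Circle, circleSum z w = (n : ℝ≥0∞) ^ 2 / 4) := by
  refine ⟨exists_sum_one_div_norm_sub_sq_le, exists_sum_one_div_inner_sq_le, fun z hz => ?_⟩
  obtain ⟨w, hw⟩ := exists_circleSum_eq_circleMin z
  exact ⟨circleMin_of_locallyExtremal hz, w, hw.trans (circleMin_of_locallyExtremal hz)⟩
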